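/- Let $\Omega\subset\mathbb{R}^d$ be a bounded convex set with at least two points (the decision set). For a sequence $f_1,\dots,f_T:\mathbb{R}^d\to\mathbb{R}$ of convex functions, each attaining its minimum over $\Omega$, let $\Omega_t^*$ be the set of minimizers of $f_t$ over $\Omega$ and define the path variation \[ V_T^p=\sup_{w_1^*\in\Omega_1^*,\dots,w_T^*\in\Omega_T^*}\ \sum_{t=1}^{T-1}\|w_t^*-w_{t+1}^*\|_2 . \] For $B_T>0$ let $\mathcal V_p$ be the set of all such sequences $(f_1,\dots,f_T)$ with $V_T^p\le B_T$. Policies and feedback. Let $U$ be a random variable with values in a measurable space $\mathbb U$. A policy $\pi$ consists of measurable maps $\pi_t:(\mathbb{R}^d)^{t-1}\times\mathbb U\to\Omega$, $t\ge1$, and plays $w_1=\pi_1(U)$ and $w_t=\pi_t(\phi_1,\dots,\phi_{t-1},U)$ for $t\ge2$. The feedback in round $t$ is a noisy subgradient $\phi_t=g_t+\epsilon_t$, where $g_t\in\partial f_t(w_t)$ (the subdifferential over $\mathbb{R}^d$) is obtained from $t$, $f_t$ and $w_t$ by an arbitrary selection that is measurable in $w_t$. Noise. The random vectors $\epsilon_1,\epsilon_2,\dots$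 in $\mathbb{R}^d$ are i.i.d. and independent of $U$, with mean zero and a covariance matrix $\Sigma$ satisfying $\operatorname{tr}\Sigma\le\lambda^2<\infty$, and their common law $P$ satisfies, for a constant $\tilde C>0$, \[ \mathrm{KL}\big(P\,\big\|\,P(\cdot+a)\big)=\int\log\frac{dP(y)}{dP(y+a)}\,dP(y)\le\tilde C\|a\|_2^2\qquad\text{for all }a\in\mathbb{R}^d . \] Regret. For a family $\mathcal V$ of sequences of $T$ loss functions put \[ \mathcal R_\phi^\pi(\mathcal V,T)=\sup_{(f_1,\dots,f_T)\in\mathcal V}\Big(\mathbb E\Big[\sum_{t=1}^Tf_t(w_t)\Big]-\sum_{t=1}^T\min_{w\in\Omega}f_t(w)\Big). \] Theorem (lower bound). For every $\kappa\in(1/2,1)$ there is a constant $C(\kappa)>0$, depending only on $\kappa$, $\tilde C$ and $\Omega$ (and not on $T$ or $B_T$), such that for every integer $T$ and real $B_T$ with $1\le B_T\le T$ there is a subfamily $\mathcal V_p'\subset\mathcal V_p$ such that every policy $\pi$, under every noisy subgradient feedback as above, satisfies \[ \mathcal R_\phi^\pi(\mathcal V_p',T)\ \ge\ C(\kappa)\,B_T^{\kappa}\,T^{1-\kappa}.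 \] Moreover, $\mathcal V_p'$ can be taken as follows: for two functions $f,g$, neither of which is strongly convex on $\Omega$, and some $\Delta\in\{1,\dots,T\}$, it consists of all sequences that, on each of the consecutive batches of $\Delta$ rounds into which $\{1,\dots,T\}$ is divided (the last one may be shorter), are constantly equal to $f$ or constantly equal to $g$. -/

import Mathlib

open MeasureTheory ProbabilityTheory InformationTheory
open scoped ENNReal

/-- The subdifferential of `f : ℝ^d → ℝ` at `x` (subgradient inequality over all of `ℝ^d`). -/
def subdifferential {d : ℕ} (f : EuclideanSpace ℝ (Fin d) → ℝ) (x : EuclideanSpace ℝ (Fin d)) :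
    Set (EuclideanSpace ℝ (Fin d)) :=
  {v | ∀ y, f x + inner ℝ v (y - x) ≤ f y}

/-- The set `Ω_t^*` of all minimizers of `f` over the decision set `Ω`. -/
def minimizers {d : ℕ} (Ω : Set (EuclideanSpace ℝ (Fin d))) (f : EuclideanSpace ℝ (Fin d) → ℝ) :
    Set (EuclideanSpace ℝ (Fin d)) :=
  {w | w ∈ Ω ∧ IsMinOn f Ω w}

/-- Path variation of `F_0, …, F_{T-1}` over `Ω`: the supremum, over all choices of minimizers
`w_t` of `F_t`, of the sum of the Euclidean distances of consecutive ones. (The values of `w`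
at times `≥ T` do not enter.) -/
noncomputable def pathVariation {d : ℕ} (Ω : Set (EuclideanSpace ℝ (Fin d))) {T : ℕ}
    (F : Fin T → EuclideanSpace ℝ (Fin d) → ℝ) : ℝ≥0∞ :=
  ⨆ (w : ℕ → EuclideanSpace ℝ (Fin d)) (_ : ∀ t : Fin T, w t ∈ minimizers Ω (F t)),
    ∑ t ∈ Finset.range (T - 1), edist (w t) (w (t + 1))

/-- The family of sequences of `T` convex loss functions that have minimizers in `Ω` and whose
path variation is at most `B`. -/
def pathVariationClass {d : ℕ} (Ω : Set (EuclideanSpace ℝ (Fin d))) (T : ℕ) (B : ℝ) :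
    Set (Fin T → EuclideanSpace ℝ (Fin d) → ℝ) :=
  {F | (∀ t, ConvexOn ℝ Set.univ (F t)) ∧ (∀ t, (minimizers Ω (F t)).Nonempty) ∧
    pathVariation Ω F ≤ ENNReal.ofReal B}

/-- The sequences of length `T` that use, on each batch `{jΔ, …, (j+1)Δ - 1}` of rounds, either
`f` throughout or `g` throughout. -/
def batchFamily {d : ℕ} (T Δ : ℕ) (f g : EuclideanSpace ℝ (Fin d) → ℝ) :
    Set (Fin T → EuclideanSpace ℝ (Fin d) → ℝ) :=
  {F | ∃ b : ℕ → Bool, ∀ t : Fin T, F t = if b ((t : ℕ) / Δ) then f else g}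

/-- `ε 0, ε 1, …` are i.i.d. random vectors, with mean zero, finite second moments, trace of
the covariance matrix at most `lam ^ 2`, and such that the Kullback-Leibler divergence of the law
`P(dy)` from its translate `P(dy + a)` (the law of `ε t - a`) is at most `K * ‖a‖ ^ 2`. -/
structure IsNoise {d : ℕ} {S : Type*} [MeasurableSpace S] (μ : Measure S)
    (ε : ℕ → S → EuclideanSpace ℝ (Fin d)) (lam K : ℝ) : Prop where
  measurable : ∀ t, Measurable (ε t)
  indep : iIndepFun ε μ
  identDistrib : ∀ t, IdentDistrib (ε t) (ε 0) μ μ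
  memLp : ∀ t, MemLp (ε t) 2 μ
  mean_zero : ∀ t, ∫ s, ε t s ∂μ = 0
  trace_cov_le : ∀ t, ∑ i, variance (fun s => ε t s i) μ ≤ lam ^ 2
  kl_le : ∀ t a, klDiv (μ.map (ε t)) (μ.map (fun s => ε t s - a)) ≤ ENNReal.ofReal (K * ‖a‖ ^ 2)

/-- A policy with decisions in `Ω` and internal randomness in `𝕌`: in round `t` (counted from `0`)
it maps the `t` feedback vectors received so far and the randomization to a decision. -/
structure Policy {d : ℕ} (Ω : Set (EuclideanSpace ℝ (Fin d))) (𝕌 : Type*)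
    [MeasurableSpace 𝕌] where
  act : (t : ℕ) → (Fin t → EuclideanSpace ℝ (Fin d)) → 𝕌 → EuclideanSpace ℝ (Fin d)
  measurable_act : ∀ t,
    Measurable (fun p : (Fin t → EuclideanSpace ℝ (Fin d)) × 𝕌 => act t p.1 p.2)
  act_mem : ∀ t h u, act t h u ∈ Ω

/-- `G t f w` is the (noiseless) subgradient of the convex function `f` at `w ∈ Ω` on which the
feedback of round `t` is based. -/
def IsSubgradientOracle {d : ℕ} (Ω : Set (EuclideanSpace ℝ (Fin d)))
    (G : ℕ → (EuclideanSpace ℝ (Fin d) → ℝ) → EuclideanSpace ℝ (Fin d) →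
      EuclideanSpace ℝ (Fin d)) : Prop :=
  ∀ t f, ConvexOn ℝ Set.univ f →
    Measurable (G t f) ∧ ∀ w ∈ Ω, G t f w ∈ subdifferential f w

/-- The feedback vectors of the first `t` rounds, `φ_τ = G τ (F τ) w_τ + e τ`, when the policy `π`
with randomization `u` faces the losses `F` and the noise realization `e`. -/
noncomputable def feedback {d : ℕ} {Ω : Set (EuclideanSpace ℝ (Fin d))} {𝕌 : Type*}
    [MeasurableSpace 𝕌] (π : Policy Ω 𝕌)
    (G : ℕ → (EuclideanSpace ℝ (Fin d) → ℝ) → EuclideanSpace ℝ (Fin d) →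
      EuclideanSpace ℝ (Fin d))
    {T : ℕ} (F : Fin T → EuclideanSpace ℝ (Fin d) → ℝ)
    (e : ℕ → EuclideanSpace ℝ (Fin d)) (u : 𝕌) :
    (t : ℕ) → t ≤ T → Fin t → EuclideanSpace ℝ (Fin d)
  | 0, _ => Fin.elim0
  | t + 1, h =>
      Fin.snoc (α := fun _ => EuclideanSpace ℝ (Fin d))
        (feedback π G F e u t (Nat.le_of_succ_le h))
        (G t (F ⟨t, h⟩) (π.act t (feedback π G F e u t (Nat.le_of_succ_le h)) u) + e t)

/-- The decision `w_t` of the policy in round `t`. -/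
noncomputable def decision {d : ℕ} {Ω : Set (EuclideanSpace ℝ (Fin d))} {𝕌 : Type*}
    [MeasurableSpace 𝕌] (π : Policy Ω 𝕌)
    (G : ℕ → (EuclideanSpace ℝ (Fin d) → ℝ) → EuclideanSpace ℝ (Fin d) →
      EuclideanSpace ℝ (Fin d))
    {T : ℕ} (F : Fin T → EuclideanSpace ℝ (Fin d) → ℝ)
    (e : ℕ → EuclideanSpace ℝ (Fin d)) (u : 𝕌) (t : Fin T) : EuclideanSpace ℝ (Fin d) :=
  π.act t (feedback π G F e u t t.isLt.le) u

/-- Dynamic regret of the policy against the loss sequence `F`. -/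
noncomputable def dynamicRegret {d : ℕ} {Ω : Set (EuclideanSpace ℝ (Fin d))} {𝕌 S : Type*}
    [MeasurableSpace 𝕌] [MeasurableSpace S] (μ : Measure S) (U : S → 𝕌)
    (ε : ℕ → S → EuclideanSpace ℝ (Fin d)) (π : Policy Ω 𝕌)
    (G : ℕ → (EuclideanSpace ℝ (Fin d) → ℝ) → EuclideanSpace ℝ (Fin d) →
      EuclideanSpace ℝ (Fin d))
    {T : ℕ} (F : Fin T → EuclideanSpace ℝ (Fin d) → ℝ) : ℝ :=
  (∫ s, ∑ t, F t (decision π G F (fun τ => ε τ s) (U s) t) ∂μ) - ∑ t, sInf (F t '' Ω)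

/-- Worst-case dynamic regret over a family `V` of loss sequences, as an extended real. -/
noncomputable def worstRegret {d : ℕ} {Ω : Set (EuclideanSpace ℝ (Fin d))} {𝕌 S : Type*}
    [MeasurableSpace 𝕌] [MeasurableSpace S] (μ : Measure S) (U : S → 𝕌)
    (ε : ℕ → S → EuclideanSpace ℝ (Fin d)) (π : Policy Ω 𝕌)
    (G : ℕ → (EuclideanSpace ℝ (Fin d) → ℝ) → EuclideanSpace ℝ (Fin d) →
      EuclideanSpace ℝ (Fin d))
    {T : ℕ} (V : Set (Fin T → EuclideanSpace ℝ (Fin d) → ℝ)) : EReal :=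
  ⨆ F ∈ V, (dynamicRegret μ U ε π G F : EReal)

/-!
Two cones with common slope `η`, whose tips `a ≠ b` lie in `Ω`, cannot both be small at the same
decision: at every point their values add up to at least `η * dist a b`. Changing the cone used on
one batch of `Δ` rounds moves each of the `Δ` subgradients by at most `2 * η`, so by the chain rule
the Kullback-Leibler divergence between the two laws of the observations is at most
`K * (2 * η) ^ 2 * Δ`. If `η` is of order `1 / √(K * Δ)`, this is at most `1 / 8` and no policy can
tell the two cases apart; averaging over all ways to assign a cone to each batch, it incurs an
expected loss of order `η * dist a b` in every round, hence a regret of order `T / √Δ`. The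
minimizer moves at most `T / Δ` times, so `Δ` can be taken of order `T / B`, and then the regret is
of order `√(B * T)`, which dominates `B ^ κ * T ^ (1 - κ)` because `B ≤ T`.
-/

lemma sq_one_sub_div_two_le_klFun {x : ℝ} (hx₀ : 0 ≤ x) (hx₁ : x ≤ 1) :
    (1 - x) ^ 2 / 2 ≤ klFun x := by
  rcases hx₀.eq_or_lt with rfl | hx₀
  · norm_num [klFun_zero]
  have hlog : (x - x⁻¹) / 2 ≤ Real.log x := by
    rw [← Real.sinh_log hx₀]
    exact Real.sinh_le_self_iff.mpr (Real.log_nonpos hx₀.le hx₁)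
  have hmul : (x ^ 2 - 1) / 2 ≤ x * Real.log x :=
    calc (x ^ 2 - 1) / 2 = x * ((x - x⁻¹) / 2) := by field_simp
      _ ≤ x * Real.log x := by gcongr
  rw [klFun_apply]
  linarith

section KullbackLeibler

variable {X Y : Type*} [MeasurableSpace X] [MeasurableSpace Y]

lemma integral_max_one_sub_rnDeriv_le_sqrt_klDiv {P Q : Measure X} [IsProbabilityMeasure P]
    [IsProbabilityMeasure Q] (hPQ : klDiv P Q ≠ ∞) :
    ∫ x, max (1 - (P.rnDeriv Q x).toReal) 0 ∂Q ≤ √(2 * (klDiv P Q).toReal) := by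
  obtain ⟨hac, hllr⟩ := klDiv_ne_top_iff.mp hPQ
  set ρ : X → ℝ := fun x => (P.rnDeriv Q x).toReal
  set δ : X → ℝ := fun x => max (1 - ρ x) 0
  have hρ_nonneg (x : X) : 0 ≤ ρ x := ENNReal.toReal_nonneg
  have hδ_mem (x : X) : δ x ∈ Set.Icc 0 1 :=
    ⟨le_max_right _ _, max_le (by linarith [hρ_nonneg x]) zero_le_one⟩
  have hδ_meas : Measurable δ :=
    ((P.measurable_rnDeriv Q).ennreal_toReal.const_sub 1).max measurable_const
  have hδ_int : Integrable δ Q := .of_mem_Icc 0 1 hδ_meas.aemeasurable (.of_forall hδ_mem)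
  have hδ_sq_int : Integrable (fun x => δ x ^ 2) Q :=
    .of_mem_Icc 0 1 (hδ_meas.pow_const 2).aemeasurable
      (.of_forall fun x => ⟨sq_nonneg _, pow_le_one₀ (hδ_mem x).1 (hδ_mem x).2⟩)
  have hδ_sq (x : X) : δ x ^ 2 ≤ 2 * klFun (ρ x) := by
    rcases le_total (ρ x) 1 with hρ | hρ
    · rw [show δ x = 1 - ρ x from max_eq_left (by linarith)]
      linarith [sq_one_sub_div_two_le_klFun (hρ_nonneg x) hρ]
    · rw [show δ x = 0 from max_eq_right (by linarith)]
      linarith [klFun_nonneg (hρ_nonneg x)]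
  refine Real.le_sqrt_of_sq_le ?_
  calc (∫ x, δ x ∂Q) ^ 2 ≤ ∫ x, δ x ^ 2 ∂Q :=
        (even_two.convexOn_pow (𝕜 := ℝ)).map_integral_le (continuous_pow 2).continuousOn
          isClosed_univ (.of_forall fun _ => Set.mem_univ _) hδ_int hδ_sq_int
    _ ≤ ∫ x, 2 * klFun (ρ x) ∂Q :=
        integral_mono hδ_sq_int (((integrable_klFun_rnDeriv_iff hac).mpr hllr).const_mul 2) hδ_sq
    _ = 2 * (klDiv P Q).toReal := by
        rw [integral_const_mul, toReal_klDiv_eq_integral_klFun hac]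

-- Pinsker's inequality up to the constant, which is `√(1 / 2)` in the sharp form.
lemma integral_sub_integral_le_mul_sqrt_klDiv {P Q : Measure X} [IsProbabilityMeasure P]
    [IsProbabilityMeasure Q] (hPQ : klDiv P Q ≠ ∞) {h : X → ℝ} (hm : Measurable h) {c : ℝ}
    (h_nonneg : ∀ x, 0 ≤ h x) (h_le : ∀ x, h x ≤ c) :
    ∫ x, h x ∂Q - ∫ x, h x ∂P ≤ c * √(2 * (klDiv P Q).toReal) := by
  have hac : P ≪ Q := (klDiv_ne_top_iff.mp hPQ).1
  set ρ : X → ℝ := fun x => (P.rnDeriv Q x).toReal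
  have hc : 0 ≤ c := by
    obtain ⟨x⟩ := P.nonempty_of_neZero
    exact (h_nonneg x).trans (h_le x)
  have h_int (R : Measure X) [IsProbabilityMeasure R] : Integrable h R :=
    .of_mem_Icc 0 c hm.aemeasurable (.of_forall fun x => ⟨h_nonneg x, h_le x⟩)
  have hρh_int : Integrable (fun x => ρ x * h x) Q :=
    (integrable_rnDeriv_smul_iff hac).mpr (h_int P)
  have hρ_pos_part_int : Integrable (fun x => max (1 - ρ x) 0) Q :=
    ((integrable_const 1).sub Measure.integrable_toReal_rnDeriv).pos_part
  calc ∫ x, h x ∂Q - ∫ x, h x ∂P = ∫ x, (h x - ρ x * h x) ∂Q := by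
        rw [integral_sub (h_int Q) hρh_int]
        exact congrArg _ (integral_rnDeriv_smul hac).symm
    _ ≤ ∫ x, c * max (1 - ρ x) 0 ∂Q := by
        refine integral_mono ((h_int Q).sub hρh_int) (hρ_pos_part_int.const_mul c) fun x => ?_
        calc h x - ρ x * h x = h x * (1 - ρ x) := by ring
          _ ≤ h x * max (1 - ρ x) 0 := mul_le_mul_of_nonneg_left (le_max_left _ _) (h_nonneg x)
          _ ≤ c * max (1 - ρ x) 0 := mul_le_mul_of_nonneg_right (h_le x) (le_max_right _ _)
    _ ≤ c * √(2 * (klDiv P Q).toReal) := by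
        rw [integral_const_mul]
        exact mul_le_mul_of_nonneg_left (integral_max_one_sub_rnDeriv_le_sqrt_klDiv hPQ) hc

/- Le Cam's two-point method: testing with `min f c`, which costs at most `f` under `P` and whose
complement `c - min f c` costs at most `g` under `Q`. -/
lemma mul_one_sub_sqrt_klDiv_le_integral_add_integral {P Q : Measure X} [IsProbabilityMeasure P]
    [IsProbabilityMeasure Q] (hPQ : klDiv P Q ≠ ∞) {f g : X → ℝ} (hf : Measurable f)
    (hfP : Integrable f P) (hgQ : Integrable g Q) (hf₀ : ∀ x, 0 ≤ f x) (hg₀ : ∀ x, 0 ≤ g x) {c : ℝ}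
    (hc : 0 ≤ c) (hfg : ∀ x, c ≤ f x + g x) :
    c * (1 - √(2 * (klDiv P Q).toReal)) ≤ ∫ x, f x ∂P + ∫ x, g x ∂Q := by
  set h : X → ℝ := fun x => min (f x) c
  have h_meas : Measurable h := hf.min measurable_const
  have h_nonneg (x : X) : 0 ≤ h x := le_min (hf₀ x) hc
  have h_le (x : X) : h x ≤ c := min_le_right _ _
  have h_int (R : Measure X) [IsProbabilityMeasure R] : Integrable h R :=
    .of_mem_Icc 0 c h_meas.aemeasurable (.of_forall fun x => ⟨h_nonneg x, h_le x⟩)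
  have hP : ∫ x, h x ∂P ≤ ∫ x, f x ∂P := integral_mono (h_int P) hfP fun x => min_le_left _ _
  have hQ : c - ∫ x, h x ∂Q ≤ ∫ x, g x ∂Q :=
    calc c - ∫ x, h x ∂Q = ∫ x, (c - h x) ∂Q := by
          rw [integral_sub (integrable_const c) (h_int Q), integral_const, probReal_univ, one_smul]
      _ ≤ ∫ x, g x ∂Q := by
          refine integral_mono ((integrable_const c).sub (h_int Q)) hgQ fun x => ?_
          rw [sub_le_iff_le_add', ← min_add_add_right]
          exact le_min (hfg x) (le_add_of_nonneg_right (hg₀ x))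
  linarith [integral_sub_integral_le_mul_sqrt_klDiv hPQ h_meas h_nonneg h_le]

lemma rnDeriv_compProd_ae_eq_kernel_rnDeriv [MeasurableSpace.CountableOrCountablyGenerated X Y]
    (P : Measure X) [IsFiniteMeasure P] {κ η : Kernel X Y} [IsFiniteKernel κ] [IsFiniteKernel η]
    (hac : ∀ x, κ x ≪ η x) :
    (P ⊗ₘ κ).rnDeriv (P ⊗ₘ η) =ᵐ[P ⊗ₘ η] fun p => κ.rnDeriv η p.1 p.2 := by
  have hκ : η.withDensity (κ.rnDeriv η) = κ := by
    ext1 x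
    exact Kernel.withDensity_rnDeriv_eq (hac x)
  have : IsSFiniteKernel (η.withDensity (κ.rnDeriv η)) := by rw [hκ]; infer_instance
  have hP : P ⊗ₘ κ = (P ⊗ₘ η).withDensity (fun p => κ.rnDeriv η p.1 p.2) := by
    rw [← Measure.compProd_withDensity (κ.measurable_rnDeriv η), hκ]
  rw [hP]
  exact Measure.rnDeriv_withDensity _ (κ.measurable_rnDeriv η)

lemma klDiv_compProd_eq_lintegral [MeasurableSpace.CountableOrCountablyGenerated X Y]
    (P : Measure X) [IsFiniteMeasure P] {κ η : Kernel X Y} [IsFiniteKernel κ] [IsFiniteKernel η]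
    (hac : ∀ x, κ x ≪ η x) :
    klDiv (P ⊗ₘ κ) (P ⊗ₘ η) = ∫⁻ x, klDiv (κ x) (η x) ∂P := by
  have hm : Measurable fun p : X × Y => ENNReal.ofReal (klFun (κ.rnDeriv η p.1 p.2).toReal) :=
    (measurable_klFun.comp (κ.measurable_rnDeriv η).ennreal_toReal).ennreal_ofReal
  calc klDiv (P ⊗ₘ κ) (P ⊗ₘ η)
      = ∫⁻ p, ENNReal.ofReal (klFun (κ.rnDeriv η p.1 p.2).toReal) ∂(P ⊗ₘ η) := by
        rw [klDiv_eq_lintegral_klFun_of_ac (.compProd_right (.of_forall hac))]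
        refine lintegral_congr_ae ?_
        filter_upwards [rnDeriv_compProd_ae_eq_kernel_rnDeriv P hac] with p hp
        rw [hp]
    _ = ∫⁻ x, ∫⁻ y, ENNReal.ofReal (klFun (κ.rnDeriv η x y).toReal) ∂(η x) ∂P :=
        Measure.lintegral_compProd hm
    _ = ∫⁻ x, klDiv (κ x) (η x) ∂P := by
        refine lintegral_congr fun x => ?_
        rw [klDiv_eq_lintegral_klFun_of_ac (hac x)]
        refine lintegral_congr_ae ?_
        filter_upwards [Kernel.rnDeriv_eq_rnDeriv_measure (κ := κ) (η := η) (a := x)] with y hy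
        rw [hy]

lemma klDiv_compProd_le_add [MeasurableSpace.CountableOrCountablyGenerated X Y] (P Q : Measure X)
    [IsProbabilityMeasure P] [IsFiniteMeasure Q] (κ η : Kernel X Y) [IsMarkovKernel κ]
    [IsMarkovKernel η] {c : ℝ≥0∞} (h : ∀ x, klDiv (κ x) (η x) ≤ c) :
    klDiv (P ⊗ₘ κ) (Q ⊗ₘ η) ≤ klDiv P Q + c := by
  rcases eq_or_ne c ∞ with rfl | hc
  · simp
  have hac (x : X) : κ x ≪ η x := (klDiv_ne_top_iff.mp (ne_top_of_le_ne_top hc (h x))).1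
  rw [klDiv_compProd_eq_add, klDiv_compProd_eq_lintegral P hac]
  gcongr
  calc ∫⁻ x, klDiv (κ x) (η x) ∂P ≤ ∫⁻ _, c ∂P := lintegral_mono h
    _ = c := by rw [lintegral_const, measure_univ, mul_one]

end KullbackLeibler

section Independence

variable {S X Y Z E : Type*} [MeasurableSpace S] [MeasurableSpace X] [MeasurableSpace Y]
  [MeasurableSpace Z] [MeasurableSpace E] {μ : Measure S} [IsProbabilityMeasure μ]

lemma indepFun_prodMk_left_of_prodMk_right {f : S → X} {g : S → Y} {h : S → Z} (hf : Measurable f)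
    (hg : Measurable g) (hh : Measurable h) (hfgh : IndepFun f (fun s => (g s, h s)) μ)
    (hgh : IndepFun g h μ) : IndepFun (fun s => (f s, g s)) h μ := by
  have hfg : IndepFun f g μ := hfgh.comp measurable_id measurable_fst
  have := Measure.isProbabilityMeasure_map (μ := μ) hf.aemeasurable
  have := Measure.isProbabilityMeasure_map (μ := μ) hg.aemeasurable
  have := Measure.isProbabilityMeasure_map (μ := μ) hh.aemeasurable
  rw [indepFun_iff_map_prod_eq_prod_map_map (by fun_prop) (by fun_prop)] at hfgh hgh hfg ⊢
  calc μ.map (fun s => ((f s, g s), h s))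
      = (μ.map (fun s => (f s, (g s, h s)))).map MeasurableEquiv.prodAssoc.symm := by
        rw [Measure.map_map (by fun_prop) (by fun_prop)]
        rfl
    _ = ((μ.map f).prod (μ.map g)).prod (μ.map h) := by
        rw [hfgh, hgh, ← Measure.prodAssoc_prod, MeasurableEquiv.map_symm_map]
    _ = (μ.map fun s => (f s, g s)).prod (μ.map h) := by rw [hfg]

lemma indepFun_pi_of_forall_ne {ι κ : Type*} {ε : ι → S → E} (hε : ∀ i, Measurable (ε i))
    (hind : iIndepFun ε μ) {i : ι} {j : κ → ι} (hj : ∀ k, j k ≠ i) :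
    IndepFun (ε i) (fun s k => ε (j k) s) μ := by
  classical
  refine .indepFun_process (hε i) (fun k => hε (j k)) fun I => ?_
  have hdisj : Disjoint {i} (I.image j) := by
    simpa [eq_comm] using fun k _ => (hj k).symm
  exact (hind.indepFun_finset {i} (I.image j) hdisj hε).comp
    (φ := fun v : ({i} : Finset ι) → E => v ⟨i, Finset.mem_singleton_self i⟩)
    (ψ := fun (v : I.image j → E) (k : I) => v ⟨j k, Finset.mem_image_of_mem j k.2⟩)
    (by fun_prop) (by fun_prop)

end Independence

section ShiftKernel

variable {X E : Type*} [MeasurableSpace X] [MeasurableSpace E] [AddCommGroup E] [MeasurableAdd₂ E]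

/-- The conditional law given `x` of the observation `v x + e`, where the noise `e` is independent
of `x` and has law `P`. -/
noncomputable def shiftKernel (P : Measure E) [SFinite P] (v : X → E) : Kernel X E :=
  (Kernel.id ×ₖ Kernel.const X P).map fun p => v p.1 + p.2

lemma shiftKernel_apply (P : Measure E) [SFinite P] {v : X → E} (hv : Measurable v) (x : X) :
    shiftKernel P v x = P.map (v x + ·) := by
  have hm : Measurable (fun p : X × E => v p.1 + p.2) := by fun_prop
  rw [shiftKernel, Kernel.map_apply _ hm, Kernel.prod_apply, Kernel.id_apply, Kernel.const_apply,
    Measure.dirac_prod, Measure.map_map hm (by fun_prop)]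
  rfl

lemma isMarkovKernel_shiftKernel (P : Measure E) [IsProbabilityMeasure P] {v : X → E}
    (hv : Measurable v) : IsMarkovKernel (shiftKernel P v) :=
  Kernel.IsMarkovKernel.map _ (by fun_prop)

lemma compProd_shiftKernel (ν : Measure X) [SFinite ν] (P : Measure E) [IsProbabilityMeasure P]
    {v : X → E} (hv : Measurable v) :
    ν ⊗ₘ shiftKernel P v = (ν.prod P).map (fun p => (p.1, v p.1 + p.2)) := by
  have := isMarkovKernel_shiftKernel P hv
  have hm : Measurable (fun p : X × E => (p.1, v p.1 + p.2)) := by fun_prop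
  ext A hA
  rw [Measure.compProd_apply hA, Measure.map_apply hm hA, Measure.prod_apply (hm hA)]
  refine lintegral_congr fun x => ?_
  rw [shiftKernel_apply P hv, Measure.map_apply (by fun_prop) (measurable_prodMk_left hA)]
  rfl

lemma klDiv_shiftKernel_le [MeasurableSub₂ E] (P : Measure E) [IsProbabilityMeasure P] {v w : X → E}
    (hv : Measurable v) (hw : Measurable w) (x : X) :
    klDiv (shiftKernel P v x) (shiftKernel P w x) ≤ klDiv P (P.map (· - (v x - w x))) := by
  have := Measure.isProbabilityMeasure_map (μ := P) (f := (· - (v x - w x))) (by fun_prop)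
  have hw_eq : shiftKernel P w x = (P.map (· - (v x - w x))).map (v x + ·) := by
    rw [shiftKernel_apply P hw, Measure.map_map (by fun_prop) (by fun_prop)]
    congr 1
    funext y
    simp only [Function.comp_apply]
    abel
  rw [shiftKernel_apply P hv, hw_eq]
  exact klDiv_map_le _ _ (by fun_prop)

end ShiftKernel

section History

variable {d : ℕ} {Ω : Set (EuclideanSpace ℝ (Fin d))} {𝕌 S : Type*} [MeasurableSpace 𝕌]
  {U : S → 𝕌} {ε : ℕ → S → EuclideanSpace ℝ (Fin d)}
  (π : Policy Ω 𝕌)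
  {G : ℕ → (EuclideanSpace ℝ (Fin d) → ℝ) → EuclideanSpace ℝ (Fin d) → EuclideanSpace ℝ (Fin d)}
  {T : ℕ} {F F' : Fin T → EuclideanSpace ℝ (Fin d) → ℝ}

variable (U ε G F) in
/-- What the policy knows before round `t` (counted from `0`): the feedback of the first `t` rounds
and its internal randomness. -/
noncomputable def history (t : ℕ) (ht : t ≤ T) (s : S) :
    (Fin t → EuclideanSpace ℝ (Fin d)) × 𝕌 :=
  (feedback π G F (fun τ => ε τ s) (U s) t ht, U s)

variable (G) in
/-- The noiseless subgradient of the loss `f` of round `t` as a function of the history. -/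
def pastSubgradient (t : ℕ) (f : EuclideanSpace ℝ (Fin d) → ℝ)
    (x : (Fin t → EuclideanSpace ℝ (Fin d)) × 𝕌) : EuclideanSpace ℝ (Fin d) :=
  G t f (π.act t x.1 x.2)

/-- Extension of the history before round `t` by the feedback `p.2` of round `t`. -/
def extendHistory {E V : Type*} {t : ℕ} (p : ((Fin t → E) × V) × E) : (Fin (t + 1) → E) × V :=
  (Fin.snoc (α := fun _ => E) p.1.1 p.2, p.1.2)

lemma measurable_extendHistory {E V : Type*} [MeasurableSpace E] [MeasurableSpace V] (t : ℕ) :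
    Measurable (extendHistory : ((Fin t → E) × V) × E → (Fin (t + 1) → E) × V) := by
  refine .prodMk (measurable_pi_lambda _ fun i => ?_) (by fun_prop)
  induction i using Fin.lastCases with
  | last =>
    simp only [Fin.snoc_last]
    fun_prop
  | cast j =>
    simp only [Fin.snoc_castSucc]
    fun_prop

lemma measurable_pastSubgradient {t : ℕ} {f : EuclideanSpace ℝ (Fin d) → ℝ}
    (hG : Measurable (G t f)) : Measurable (pastSubgradient π G t f) :=
  hG.comp (π.measurable_act t)

variable [MeasurableSpace S]

lemma measurable_history (hU : Measurable U) (hε : ∀ t, Measurable (ε t))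
    (hG : ∀ t : Fin T, Measurable (G t (F t))) (t : ℕ) (ht : t ≤ T) :
    Measurable (history U ε π G F t ht) := by
  induction t with
  | zero => exact .prodMk (measurable_pi_lambda _ fun i => i.elim0) hU
  | succ t ih =>
    have hH := ih (Nat.le_of_succ_le ht)
    have hv := measurable_pastSubgradient π (hG ⟨t, ht⟩)
    exact (measurable_extendHistory t).comp (hH.prodMk ((hv.comp hH).add (hε t)))

variable {μ : Measure S} [IsProbabilityMeasure μ]

lemma indepFun_history_future (hU : Measurable U) (hε : ∀ t, Measurable (ε t))
    (hind : iIndepFun ε μ) (hUε : IndepFun U (fun s t => ε t s) μ)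
    (hG : ∀ t : Fin T, Measurable (G t (F t))) (t : ℕ) (ht : t ≤ T) :
    IndepFun (history U ε π G F t ht) (fun s n => ε (t + n) s) μ := by
  induction t with
  | zero =>
    simp only [zero_add]
    exact hUε.comp (φ := fun u => (Fin.elim0, u)) (by fun_prop) measurable_id
  | succ t ih =>
    have ht' : t ≤ T := Nat.le_of_succ_le ht
    have hH := measurable_history π hU hε hG t ht'
    have hv := measurable_pastSubgradient π (hG ⟨t, ht⟩)
    have h_split : IndepFun (history U ε π G F t ht')
        (fun s => (ε t s, fun n => ε (t + 1 + n) s)) μ := by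
      simp only [Nat.add_assoc]
      exact (ih ht').comp (ψ := fun e : ℕ → EuclideanSpace ℝ (Fin d) => (e 0, fun n => e (1 + n)))
        measurable_id (by fun_prop)
    have h_noise : IndepFun (ε t) (fun s n => ε (t + 1 + n) s) μ :=
      indepFun_pi_of_forall_ne hε hind fun n => by omega
    have h_extend : Measurable
        fun p : ((Fin t → EuclideanSpace ℝ (Fin d)) × 𝕌) × EuclideanSpace ℝ (Fin d) =>
          extendHistory (p.1, pastSubgradient π G t (F ⟨t, ht⟩) p.1 + p.2) :=
      (measurable_extendHistory t).comp (by fun_prop)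
    exact (indepFun_prodMk_left_of_prodMk_right hH (hε t) (by fun_prop) h_split h_noise).comp
      h_extend measurable_id

lemma map_history_succ (hU : Measurable U) (hε : ∀ t, Measurable (ε t)) (hind : iIndepFun ε μ)
    (hUε : IndepFun U (fun s t => ε t s) μ) (hG : ∀ t : Fin T, Measurable (G t (F t)))
    (t : ℕ) (ht : t + 1 ≤ T) :
    μ.map (history U ε π G F (t + 1) ht) =
      (μ.map (history U ε π G F t (Nat.le_of_succ_le ht)) ⊗ₘ
        shiftKernel (μ.map (ε t)) (pastSubgradient π G t (F ⟨t, ht⟩))).map extendHistory := by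
  have hH := measurable_history π hU hε hG t (Nat.le_of_succ_le ht)
  have hv := measurable_pastSubgradient π (hG ⟨t, ht⟩)
  have h_indep : IndepFun (history U ε π G F t (Nat.le_of_succ_le ht)) (ε t) μ :=
    (indepFun_history_future π hU hε hind hUε hG t (Nat.le_of_succ_le ht)).comp
      measurable_id (measurable_pi_apply 0)
  have := Measure.isProbabilityMeasure_map (μ := μ) (hε t).aemeasurable
  rw [compProd_shiftKernel _ _ hv,
    ← (indepFun_iff_map_prod_eq_prod_map_map hH.aemeasurable (hε t).aemeasurable).mp h_indep,
    Measure.map_map (by fun_prop) (hH.prodMk (hε t)),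
    Measure.map_map (measurable_extendHistory t) (by fun_prop)]
  rfl

lemma klDiv_shiftKernel_noise_le {X : Type*} [MeasurableSpace X] {lam K : ℝ}
    (hε : IsNoise μ ε lam K) (t : ℕ) {v w : X → EuclideanSpace ℝ (Fin d)} (hv : Measurable v)
    (hw : Measurable w) (x : X) :
    klDiv (shiftKernel (μ.map (ε t)) v x) (shiftKernel (μ.map (ε t)) w x) ≤
      ENNReal.ofReal (K * ‖v x - w x‖ ^ 2) := by
  have := Measure.isProbabilityMeasure_map (μ := μ) (hε.measurable t).aemeasurable
  refine (klDiv_shiftKernel_le _ hv hw x).trans ?_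
  rw [Measure.map_map (by fun_prop) (hε.measurable t)]
  exact hε.kl_le t _

lemma klDiv_history_le {lam K : ℝ} (hK : 0 ≤ K) (hU : Measurable U) (hε : IsNoise μ ε lam K)
    (hUε : IndepFun U (fun s t => ε t s) μ) (hG : ∀ t : Fin T, Measurable (G t (F t)))
    (hG' : ∀ t : Fin T, Measurable (G t (F' t))) {r : ℕ → ℝ}
    (hr : ∀ t : Fin T, ∀ w ∈ Ω, ‖G t (F t) w - G t (F' t) w‖ ≤ r t) (t : ℕ) (ht : t ≤ T) :
    klDiv (μ.map (history U ε π G F t ht)) (μ.map (history U ε π G F' t ht)) ≤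
      ∑ τ ∈ Finset.range t, ENNReal.ofReal (K * r τ ^ 2) := by
  induction t with
  | zero =>
    have h_eq : history U ε π G F 0 ht = history U ε π G F' 0 ht := rfl
    have := Measure.isProbabilityMeasure_map (μ := μ)
      (measurable_history π hU hε.measurable hG' 0 ht).aemeasurable
    rw [h_eq, klDiv_self, Finset.range_zero, Finset.sum_empty]
  | succ t ih =>
    have ht' : t ≤ T := Nat.le_of_succ_le ht
    have hH := measurable_history π hU hε.measurable hG t ht'
    have hH' := measurable_history π hU hε.measurable hG' t ht'
    have hv := measurable_pastSubgradient π (hG ⟨t, ht⟩)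
    have hv' := measurable_pastSubgradient π (hG' ⟨t, ht⟩)
    have := Measure.isProbabilityMeasure_map (μ := μ) (hε.measurable t).aemeasurable
    have := Measure.isProbabilityMeasure_map (μ := μ) hH.aemeasurable
    have := Measure.isProbabilityMeasure_map (μ := μ) hH'.aemeasurable
    have := isMarkovKernel_shiftKernel (μ.map (ε t)) hv
    have := isMarkovKernel_shiftKernel (μ.map (ε t)) hv'
    rw [map_history_succ π hU hε.measurable hε.indep hUε hG t ht,
      map_history_succ π hU hε.measurable hε.indep hUε hG' t ht, Finset.sum_range_succ]
    refine (klDiv_map_le _ _ (measurable_extendHistory t)).trans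
      ((klDiv_compProd_le_add _ _ _ _ fun x => ?_).trans (add_le_add_left (ih ht') _))
    refine (klDiv_shiftKernel_noise_le hε t hv hv' x).trans ?_
    gcongr
    exact hr ⟨t, ht⟩ _ (π.act_mem t x.1 x.2)

end History

lemma norm_le_of_mem_subdifferential {d : ℕ} {f : EuclideanSpace ℝ (Fin d) → ℝ} {L : NNReal}
    (hf : LipschitzWith L f) {v w : EuclideanSpace ℝ (Fin d)} (hv : v ∈ subdifferential f w) :
    ‖v‖ ≤ L := by
  have h_sq : ‖v‖ * ‖v‖ ≤ L * ‖v‖ :=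
    calc ‖v‖ * ‖v‖ ≤ f (w + v) - f w := by
          have := hv (w + v)
          rw [add_sub_cancel_left, real_inner_self_eq_norm_mul_norm] at this
          linarith
      _ ≤ L * ‖v‖ := by simpa using (le_abs_self _).trans (hf.dist_le_mul (w + v) w)
  rcases (norm_nonneg v).eq_or_lt with h | h
  · rw [← h]
    exact L.coe_nonneg
  · exact le_of_mul_le_mul_right h_sq h

section Cone

/-- The cone-shaped loss with slope `η` and tip `a`. -/
def cone {E : Type*} [PseudoMetricSpace E] (η : NNReal) (a x : E) : ℝ :=
  η * dist x a

lemma cone_self {E : Type*} [PseudoMetricSpace E] (η : NNReal) (a : E) : cone η a a = 0 := by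
  rw [cone, dist_self, mul_zero]

lemma cone_nonneg {E : Type*} [PseudoMetricSpace E] (η : NNReal) (a x : E) : 0 ≤ cone η a x :=
  mul_nonneg η.coe_nonneg dist_nonneg

lemma lipschitzWith_cone {E : Type*} [PseudoMetricSpace E] (η : NNReal) (a : E) :
    LipschitzWith η (cone η a) :=
  .of_dist_le_mul fun x y => by
    rw [Real.dist_eq, cone, cone, ← mul_sub, abs_mul, NNReal.abs_eq]
    gcongr
    exact abs_dist_sub_le x y a

lemma mul_dist_le_cone_add_cone {E : Type*} [PseudoMetricSpace E] (η : NNReal) (a b x : E) :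
    η * dist a b ≤ cone η a x + cone η b x := by
  rw [cone, cone, ← mul_add]
  gcongr
  exact dist_triangle_left a b x

lemma sInf_cone_image {E : Type*} [PseudoMetricSpace E] (η : NNReal) {s : Set E} {a : E}
    (ha : a ∈ s) : sInf (cone η a '' s) = 0 :=
  IsLeast.csInf_eq ⟨⟨a, ha, cone_self η a⟩, Set.forall_mem_image.mpr fun x _ => cone_nonneg η a x⟩

lemma convexOn_cone {E : Type*} [SeminormedAddCommGroup E] [NormedSpace ℝ E] (η : NNReal) (a : E) :
    ConvexOn ℝ Set.univ (cone η a) :=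
  (convexOn_dist a convex_univ).smul η.coe_nonneg

lemma not_strongConvexOn_cone {E : Type*} [NormedAddCommGroup E] [NormedSpace ℝ E] (η : NNReal)
    {s : Set E} {a b : E} (ha : a ∈ s) (hb : b ∈ s) (hab : a ≠ b) {m : ℝ} (hm : 0 < m) :
    ¬ StrongConvexOn s m (cone η a) := by
  intro h
  have h_mid : cone η a ((1 / 2 : ℝ) • a + (1 / 2 : ℝ) • b) = 1 / 2 * cone η a b := by
    have : (1 / 2 : ℝ) • a + (1 / 2 : ℝ) • b - a = (1 / 2 : ℝ) • (b - a) := by module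
    rw [cone, cone, dist_eq_norm, dist_eq_norm, this, norm_smul, Real.norm_eq_abs,
      abs_of_pos one_half_pos, mul_left_comm]
  have h_strong := h.2 ha hb one_half_pos.le one_half_pos.le (add_halves 1)
  rw [h_mid, cone_self, smul_eq_mul, smul_eq_mul] at h_strong
  have h_modulus : 0 < m * ‖a - b‖ ^ 2 :=
    mul_pos hm (pow_pos (norm_sub_pos_iff.mpr hab) 2)
  linarith

end Cone

section PathVariation

variable {d : ℕ} {Ω : Set (EuclideanSpace ℝ (Fin d))} {a b : EuclideanSpace ℝ (Fin d)}
  {f g : EuclideanSpace ℝ (Fin d) → ℝ} {T Δ : ℕ}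

lemma minimizers_cone {η : NNReal} (hη : 0 < η) (ha : a ∈ Ω) : minimizers Ω (cone η a) = {a} := by
  ext w
  constructor
  · rintro ⟨-, hw⟩
    have h_le : cone η a w ≤ 0 := (hw ha).trans_eq (cone_self η a)
    exact dist_le_zero.mp (nonpos_of_mul_nonpos_right h_le (NNReal.coe_pos.mpr hη))
  · rintro rfl
    exact ⟨ha, fun x _ => (cone_self η w).trans_le (cone_nonneg η w x)⟩

-- The minimizer can only move at a round `t + 1` that starts a new batch.
lemma pathVariation_le_of_mem_batchFamily (hf : minimizers Ω f = {a}) (hg : minimizers Ω g = {b})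
    {F : Fin T → EuclideanSpace ℝ (Fin d) → ℝ} (hF : F ∈ batchFamily T Δ f g) :
    pathVariation Ω F ≤ ((T - 1) / Δ : ℕ) * edist a b := by
  obtain ⟨c, hc⟩ := hF
  refine iSup₂_le fun w hw => ?_
  have hw_eq : ∀ t < T, w t = if c (t / Δ) then a else b := by
    intro t ht
    have hwt := hw ⟨t, ht⟩
    rw [hc] at hwt
    dsimp only at hwt
    split_ifs at hwt ⊢
    · rwa [hf] at hwt
    · rwa [hg] at hwt
  calc ∑ t ∈ Finset.range (T - 1), edist (w t) (w (t + 1))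
      ≤ ∑ t ∈ Finset.range (T - 1), if Δ ∣ t + 1 then edist a b else 0 := by
        refine Finset.sum_le_sum fun t ht => ?_
        rw [Finset.mem_range] at ht
        rw [hw_eq t (by omega), hw_eq (t + 1) (by omega)]
        by_cases h_dvd : Δ ∣ t + 1
        · rw [if_pos h_dvd]
          split_ifs <;> simp [edist_comm]
        · rw [Nat.succ_div_of_not_dvd h_dvd, edist_self]
          exact zero_le
    _ = ((T - 1) / Δ : ℕ) * edist a b := by
        rw [← Finset.sum_filter, Finset.sum_const, Nat.card_multiples, nsmul_eq_mul]

lemma batchFamily_subset_pathVariationClass (hf : ConvexOn ℝ Set.univ f)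
    (hg : ConvexOn ℝ Set.univ g) (hfa : minimizers Ω f = {a}) (hgb : minimizers Ω g = {b}) {B : ℝ}
    (hB : ((T - 1) / Δ : ℕ) * dist a b ≤ B) : batchFamily T Δ f g ⊆ pathVariationClass Ω T B := by
  intro F hF
  refine ⟨fun t => ?_, fun t => ?_, (pathVariation_le_of_mem_batchFamily hfa hgb hF).trans ?_⟩
  · obtain ⟨c, hc⟩ := hF
    rw [hc]
    split_ifs
    exacts [hf, hg]
  · obtain ⟨c, hc⟩ := hF
    rw [hc]
    split_ifs
    · exact hfa ▸ Set.singleton_nonempty a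
    · exact hgb ▸ Set.singleton_nonempty b
  · rw [edist_dist, ← ENNReal.ofReal_natCast, ← ENNReal.ofReal_mul (Nat.cast_nonneg _)]
    exact ENNReal.ofReal_le_ofReal hB

end PathVariation

section Batches

lemma exists_card_mul_le_sum_of_le_add_perm {τ β : Type*} [Fintype τ] [Finite β] [Nonempty β]
    (σ : τ → Equiv.Perm β) (L : τ → β → ℝ) {r : ℝ} (h : ∀ t c, 2 * r ≤ L t c + L t (σ t c)) :
    ∃ c, Fintype.card τ * r ≤ ∑ t, L t c := by
  have := Fintype.ofFinite β
  have h_round (t : τ) : ∑ _c : β, r ≤ ∑ c, L t c := by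
    have h_sum : ∑ c, 2 * r ≤ ∑ c, (L t c + L t (σ t c)) := Finset.sum_le_sum fun c _ => h t c
    rw [Finset.sum_add_distrib, Equiv.sum_comp (σ t) (L t), ← Finset.mul_sum] at h_sum
    linarith
  have h_total : ∑ _c : β, Fintype.card τ * r ≤ ∑ c, ∑ t, L t c :=
    calc ∑ _c : β, Fintype.card τ * r = ∑ _t : τ, ∑ _c : β, r := by
          simp only [Finset.sum_const, Finset.card_univ, nsmul_eq_mul]
          ring
      _ ≤ ∑ t, ∑ c, L t c := Finset.sum_le_sum fun t _ => h_round t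
      _ = ∑ c, ∑ t, L t c := Finset.sum_comm
  obtain ⟨c, -, hc⟩ := Finset.exists_le_of_sum_le Finset.univ_nonempty h_total
  exact ⟨c, hc⟩

/-- The involution of the bit vectors that flips the `j`-th bit. -/
def flipBit {ι : Type*} [DecidableEq ι] (j : ι) : Equiv.Perm (ι → Bool) :=
  Function.Involutive.toPerm (fun c => Function.update c j (!c j)) fun c => by simp

lemma flipBit_apply_self {ι : Type*} [DecidableEq ι] (j : ι) (c : ι → Bool) :
    flipBit j c j = !c j :=
  Function.update_self ..

lemma flipBit_apply_of_ne {ι : Type*} [DecidableEq ι] {i j : ι} (hij : i ≠ j) (c : ι → Bool) :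
    flipBit j c i = c i :=
  Function.update_of_ne hij ..

/-- The number `t / Δ` of the batch of length `Δ` that contains the round `t`. -/
def batchIndex {T : ℕ} (Δ : ℕ) (t : Fin T) : Fin T :=
  ⟨t / Δ, (Nat.div_le_self _ _).trans_lt t.isLt⟩

/-- The sequence of losses that is constantly equal to `f` or to `g` on each batch of length `Δ`,
according to the bit that `c` assigns to the batch. There are `T` bits, enough even for `Δ = 1`. -/
def batchSequence {X : Type*} {T : ℕ} (Δ : ℕ) (f g : X → ℝ) (c : Fin T → Bool) (t : Fin T) :
    X → ℝ :=
  if c (batchIndex Δ t) then f else g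

variable {X : Type*} {T Δ : ℕ} {f g : X → ℝ}

lemma batchSequence_mem_batchFamily {d : ℕ} (f g : EuclideanSpace ℝ (Fin d) → ℝ)
    (c : Fin T → Bool) : batchSequence Δ f g c ∈ batchFamily T Δ f g := by
  refine ⟨fun n => if h : n < T then c ⟨n, h⟩ else false, fun t => ?_⟩
  have h_bit : (if h : t / Δ < T then c ⟨t / Δ, h⟩ else false) = c (batchIndex Δ t) :=
    dif_pos (batchIndex Δ t).isLt
  simp only [h_bit, batchSequence]

lemma forall_batchSequence {p : (X → ℝ) → Prop} (hf : p f) (hg : p g) (c : Fin T → Bool)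
    (t : Fin T) : p (batchSequence Δ f g c t) := by
  rw [batchSequence]
  split_ifs
  exacts [hf, hg]

lemma batchSequence_flipBit_of_ne {j t : Fin T} (h : (t / Δ : ℕ) ≠ j) (c : Fin T → Bool) :
    batchSequence Δ f g (flipBit j c) t = batchSequence Δ f g c t := by
  rw [batchSequence, batchSequence, flipBit_apply_of_ne (Fin.ne_of_val_ne h)]

lemma add_batchSequence_flipBit {φ : (X → ℝ) → ℝ} (c : Fin T → Bool) (t : Fin T) :
    φ (batchSequence Δ f g c t) + φ (batchSequence Δ f g (flipBit (batchIndex Δ t) c) t) =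
      φ f + φ g := by
  rw [batchSequence, batchSequence, flipBit_apply_self]
  cases c (batchIndex Δ t)
  · exact add_comm _ _
  · rfl

lemma card_filter_div_eq_le (hΔ : 0 < Δ) (t j : ℕ) :
    ((Finset.range t).filter (· / Δ = j)).card ≤ Δ := by
  have h_subset : (Finset.range t).filter (· / Δ = j) ⊆ Finset.Ico (j * Δ) ((j + 1) * Δ) := by
    intro τ hτ
    obtain rfl := (Finset.mem_filter.mp hτ).2
    exact Finset.mem_Ico.mpr ⟨Nat.div_mul_le_self τ Δ, Nat.lt_mul_of_div_lt (Nat.lt_succ_self _) hΔ⟩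
  exact (Finset.card_le_card h_subset).trans (by simp [Nat.add_mul])

end Batches

section ExcessLoss

variable {d : ℕ} {Ω : Set (EuclideanSpace ℝ (Fin d))} {𝕌 : Type*} [MeasurableSpace 𝕌]
  {f : EuclideanSpace ℝ (Fin d) → ℝ} {L : NNReal}

variable (Ω f) in
/-- The loss in excess of the best decision in `Ω`. It is nonnegative on `Ω` only if `f` is bounded
below on `Ω`, as `sInf` is `0` otherwise. -/
noncomputable def excessLoss (x : EuclideanSpace ℝ (Fin d)) : ℝ :=
  f x - sInf (f '' Ω)

lemma excessLoss_nonneg (hbdd : Bornology.IsBounded Ω) (hf : LipschitzWith L f)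
    {x : EuclideanSpace ℝ (Fin d)} (hx : x ∈ Ω) : 0 ≤ excessLoss Ω f x :=
  sub_nonneg.mpr (csInf_le (hf.isBounded_image hbdd).bddBelow (Set.mem_image_of_mem f hx))

lemma measurable_excessLoss_act (hf : LipschitzWith L f) (π : Policy Ω 𝕌) (t : ℕ) :
    Measurable fun x : (Fin t → EuclideanSpace ℝ (Fin d)) × 𝕌 =>
      excessLoss Ω f (π.act t x.1 x.2) :=
  (hf.continuous.measurable.comp (π.measurable_act t)).sub_const _

lemma integrable_loss_act (hbdd : Bornology.IsBounded Ω) (hf : LipschitzWith L f) (π : Policy Ω 𝕌)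
    (t : ℕ) (ν : Measure ((Fin t → EuclideanSpace ℝ (Fin d)) × 𝕌)) [IsFiniteMeasure ν] :
    Integrable (fun x => f (π.act t x.1 x.2)) ν := by
  obtain ⟨R, hR⟩ := (hf.isBounded_image hbdd).exists_norm_le
  exact .of_bound (hf.continuous.measurable.comp (π.measurable_act t)).aestronglyMeasurable R
    (.of_forall fun x => hR _ (Set.mem_image_of_mem f (π.act_mem t x.1 x.2)))

lemma integrable_excessLoss_act (hbdd : Bornology.IsBounded Ω) (hf : LipschitzWith L f)
    (π : Policy Ω 𝕌) (t : ℕ) (ν : Measure ((Fin t → EuclideanSpace ℝ (Fin d)) × 𝕌))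
    [IsFiniteMeasure ν] : Integrable (fun x => excessLoss Ω f (π.act t x.1 x.2)) ν :=
  (integrable_loss_act hbdd hf π t ν).sub (integrable_const _)

lemma excessLoss_cone (η : NNReal) {a : EuclideanSpace ℝ (Fin d)} (ha : a ∈ Ω) :
    excessLoss Ω (cone η a) = cone η a := by
  funext x
  rw [excessLoss, sInf_cone_image η ha, sub_zero]

end ExcessLoss

section Regret

variable {d : ℕ} {Ω : Set (EuclideanSpace ℝ (Fin d))} {𝕌 S : Type*} [MeasurableSpace 𝕌]
  {π : Policy Ω 𝕌}
  {G : ℕ → (EuclideanSpace ℝ (Fin d) → ℝ) → EuclideanSpace ℝ (Fin d) → EuclideanSpace ℝ (Fin d)}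
  {T Δ : ℕ} {F F' : Fin T → EuclideanSpace ℝ (Fin d) → ℝ} {f g : EuclideanSpace ℝ (Fin d) → ℝ}
  {L : NNReal}

lemma norm_oracle_sub_le (hG : IsSubgradientOracle Ω G) (hf : ConvexOn ℝ Set.univ f)
    (hg : ConvexOn ℝ Set.univ g) (hfL : LipschitzWith L f) (hgL : LipschitzWith L g) (t : ℕ)
    {w : EuclideanSpace ℝ (Fin d)} (hw : w ∈ Ω) : ‖G t f w - G t g w‖ ≤ 2 * L :=
  calc ‖G t f w - G t g w‖ ≤ ‖G t f w‖ + ‖G t g w‖ := norm_sub_le _ _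
    _ ≤ L + L := add_le_add (norm_le_of_mem_subdifferential hfL ((hG t f hf).2 w hw))
        (norm_le_of_mem_subdifferential hgL ((hG t g hg).2 w hw))
    _ = 2 * L := (two_mul _).symm

variable [MeasurableSpace S] {μ : Measure S} [IsProbabilityMeasure μ] {U : S → 𝕌}
  {ε : ℕ → S → EuclideanSpace ℝ (Fin d)} {lam K : ℝ}

lemma klDiv_history_le_of_eq_off_batch (hK : 0 ≤ K) (hU : Measurable U) (hε : IsNoise μ ε lam K)
    (hUε : IndepFun U (fun s t => ε t s) μ) (hG : IsSubgradientOracle Ω G)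
    (hF : ∀ t, ConvexOn ℝ Set.univ (F t)) (hF' : ∀ t, ConvexOn ℝ Set.univ (F' t))
    (hFL : ∀ t, LipschitzWith L (F t)) (hFL' : ∀ t, LipschitzWith L (F' t)) (hΔ : 0 < Δ) {j : ℕ}
    (h_eq : ∀ t : Fin T, (t / Δ : ℕ) ≠ j → F' t = F t) (t : ℕ) (ht : t ≤ T) :
    klDiv (μ.map (history U ε π G F t ht)) (μ.map (history U ε π G F' t ht)) ≤
      ENNReal.ofReal (Δ * (K * (2 * L) ^ 2)) := by
  have h_dist (τ : Fin T) (w : EuclideanSpace ℝ (Fin d)) (hw : w ∈ Ω) :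
      ‖G τ (F τ) w - G τ (F' τ) w‖ ≤ if (τ / Δ : ℕ) = j then 2 * (L : ℝ) else 0 := by
    split_ifs with hτ
    · exact norm_oracle_sub_le hG (hF τ) (hF' τ) (hFL τ) (hFL' τ) τ hw
    · rw [h_eq τ hτ, sub_self, norm_zero]
  calc klDiv (μ.map (history U ε π G F t ht)) (μ.map (history U ε π G F' t ht))
      ≤ ∑ τ ∈ Finset.range t, ENNReal.ofReal (K * (if τ / Δ = j then 2 * (L : ℝ) else 0) ^ 2) :=
        klDiv_history_le π hK hU hε hUε (fun τ => (hG τ _ (hF τ)).1)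
          (fun τ => (hG τ _ (hF' τ)).1) h_dist t ht
    _ = ∑ τ ∈ Finset.range t, if τ / Δ = j then ENNReal.ofReal (K * (2 * L) ^ 2) else 0 := by
        refine Finset.sum_congr rfl fun τ _ => ?_
        split_ifs <;> simp
    _ = ((Finset.range t).filter (· / Δ = j)).card * ENNReal.ofReal (K * (2 * L) ^ 2) := by
        rw [← Finset.sum_filter, Finset.sum_const, nsmul_eq_mul]
    _ ≤ Δ * ENNReal.ofReal (K * (2 * L) ^ 2) := by
        gcongr
        exact card_filter_div_eq_le hΔ t j
    _ = ENNReal.ofReal (Δ * (K * (2 * L) ^ 2)) := by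
        rw [ENNReal.ofReal_mul (Nat.cast_nonneg _), ENNReal.ofReal_natCast]

variable (π G F μ U ε) in
/-- The expected excess loss of the policy in round `t`, as an integral over the law of the history
on which the decision of that round is based. -/
noncomputable def expectedExcessLoss (t : Fin T) : ℝ :=
  ∫ x, excessLoss Ω (F t) (π.act t x.1 x.2) ∂(μ.map (history U ε π G F t t.isLt.le))

lemma dynamicRegret_eq_sum_expectedExcessLoss (hbdd : Bornology.IsBounded Ω) (hU : Measurable U)
    (hε : ∀ t, Measurable (ε t)) (hG : ∀ t : Fin T, Measurable (G t (F t)))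
    (hFL : ∀ t, LipschitzWith L (F t)) :
    dynamicRegret μ U ε π G F = ∑ t, expectedExcessLoss π G F μ U ε t := by
  have hH (t : Fin T) := measurable_history π hU hε hG t t.isLt.le
  have : ∀ t : Fin T, IsProbabilityMeasure (μ.map (history U ε π G F t t.isLt.le)) :=
    fun t => Measure.isProbabilityMeasure_map (hH t).aemeasurable
  have h_int (t : Fin T) :
      Integrable (fun s => F t (decision π G F (fun τ => ε τ s) (U s) t)) μ :=
    (integrable_loss_act hbdd (hFL t) π t _).comp_measurable (hH t)
  rw [dynamicRegret, integral_finsetSum _ fun t _ => h_int t, ← Finset.sum_sub_distrib]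
  refine Finset.sum_congr rfl fun t _ => ?_
  calc ∫ s, F t (decision π G F (fun τ => ε τ s) (U s) t) ∂μ - sInf (F t '' Ω)
      = ∫ s, excessLoss Ω (F t) (decision π G F (fun τ => ε τ s) (U s) t) ∂μ := by
        simp only [excessLoss]
        rw [integral_sub (h_int t) (integrable_const _), integral_const, probReal_univ, one_smul]
    _ = expectedExcessLoss π G F μ U ε t :=
        (integral_map (hH t).aemeasurable
          (measurable_excessLoss_act (hFL t) π t).aestronglyMeasurable).symm

lemma le_expectedExcessLoss_add_expectedExcessLoss (hbdd : Bornology.IsBounded Ω)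
    (hU : Measurable U) (hε : ∀ t, Measurable (ε t)) (hG : ∀ t : Fin T, Measurable (G t (F t)))
    (hG' : ∀ t : Fin T, Measurable (G t (F' t))) (hFL : ∀ t, LipschitzWith L (F t))
    (hFL' : ∀ t, LipschitzWith L (F' t)) {c : ℝ} (hc : 0 ≤ c) (t : Fin T)
    (h_sep : ∀ x ∈ Ω, c ≤ excessLoss Ω (F t) x + excessLoss Ω (F' t) x)
    (h_kl : klDiv (μ.map (history U ε π G F t t.isLt.le))
      (μ.map (history U ε π G F' t t.isLt.le)) ≤ ENNReal.ofReal (1 / 8)) :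
    c / 2 ≤ expectedExcessLoss π G F μ U ε t + expectedExcessLoss π G F' μ U ε t := by
  have := Measure.isProbabilityMeasure_map (μ := μ)
    (measurable_history π hU hε hG t t.isLt.le).aemeasurable
  have := Measure.isProbabilityMeasure_map (μ := μ)
    (measurable_history π hU hε hG' t t.isLt.le).aemeasurable
  have h_sqrt : √(2 * (klDiv (μ.map (history U ε π G F t t.isLt.le))
      (μ.map (history U ε π G F' t t.isLt.le))).toReal) ≤ 1 / 2 := by
    rw [Real.sqrt_le_left one_half_pos.le]
    linarith [ENNReal.toReal_le_of_le_ofReal (by norm_num) h_kl]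
  calc c / 2 ≤ c * (1 - √(2 * (klDiv (μ.map (history U ε π G F t t.isLt.le))
        (μ.map (history U ε π G F' t t.isLt.le))).toReal)) := by
        rw [div_eq_mul_one_div]
        gcongr
        linarith
    _ ≤ _ := mul_one_sub_sqrt_klDiv_le_integral_add_integral
        (ne_top_of_le_ne_top ENNReal.ofReal_ne_top h_kl) (measurable_excessLoss_act (hFL t) π t)
        (integrable_excessLoss_act hbdd (hFL t) π t _)
        (integrable_excessLoss_act hbdd (hFL' t) π t _)
        (fun x => excessLoss_nonneg hbdd (hFL t) (π.act_mem t x.1 x.2))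
        (fun x => excessLoss_nonneg hbdd (hFL' t) (π.act_mem t x.1 x.2)) hc
        (fun x => h_sep _ (π.act_mem t x.1 x.2))

lemma exists_batchFamily_mul_le_dynamicRegret (hbdd : Bornology.IsBounded Ω) (hK : 0 ≤ K)
    (hU : Measurable U) (hε : IsNoise μ ε lam K) (hUε : IndepFun U (fun s t => ε t s) μ)
    (hG : IsSubgradientOracle Ω G) (hf : ConvexOn ℝ Set.univ f) (hg : ConvexOn ℝ Set.univ g)
    (hfL : LipschitzWith L f) (hgL : LipschitzWith L g) {c : ℝ} (hc : 0 ≤ c)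
    (h_sep : ∀ x ∈ Ω, c ≤ excessLoss Ω f x + excessLoss Ω g x) (hΔ : 0 < Δ)
    (hΔL : Δ * (K * (2 * L) ^ 2) ≤ 1 / 8) :
    ∃ F ∈ batchFamily T Δ f g, T * (c / 4) ≤ dynamicRegret μ U ε π G F := by
  let F : (Fin T → Bool) → Fin T → EuclideanSpace ℝ (Fin d) → ℝ := batchSequence Δ f g
  have hF (b : Fin T → Bool) (t : Fin T) : ConvexOn ℝ Set.univ (F b t) :=
    forall_batchSequence hf hg b t
  have hFL (b : Fin T → Bool) (t : Fin T) : LipschitzWith L (F b t) :=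
    forall_batchSequence hfL hgL b t
  have hGF (b : Fin T → Bool) (t : Fin T) : Measurable (G t (F b t)) := (hG t _ (hF b t)).1
  have h_pair (t : Fin T) (b : Fin T → Bool) :
      2 * (c / 4) ≤ expectedExcessLoss π G (F b) μ U ε t +
        expectedExcessLoss π G (F (flipBit (batchIndex Δ t) b)) μ U ε t := by
    have h_kl := klDiv_history_le_of_eq_off_batch (π := π) hK hU hε hUε hG (hF b)
      (hF (flipBit (batchIndex Δ t) b)) (hFL b) (hFL _) hΔ (j := t / Δ)
      (fun τ hτ => batchSequence_flipBit_of_ne hτ b) t t.isLt.le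
    have h_sep_flip (x : EuclideanSpace ℝ (Fin d)) (hx : x ∈ Ω) :
        c ≤ excessLoss Ω (F b t) x + excessLoss Ω (F (flipBit (batchIndex Δ t) b) t) x :=
      (h_sep x hx).trans_eq (add_batchSequence_flipBit (φ := (excessLoss Ω · x)) b t).symm
    linarith [le_expectedExcessLoss_add_expectedExcessLoss hbdd hU hε.measurable (hGF b) (hGF _)
      (hFL b) (hFL _) hc t h_sep_flip (h_kl.trans (ENNReal.ofReal_le_ofReal hΔL))]
  obtain ⟨b, hb⟩ := exists_card_mul_le_sum_of_le_add_perm (fun t => flipBit (batchIndex Δ t))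
    (fun t b => expectedExcessLoss π G (F b) μ U ε t) h_pair
  refine ⟨F b, batchSequence_mem_batchFamily f g b, ?_⟩
  rw [Fintype.card_fin] at hb
  rwa [dynamicRegret_eq_sum_expectedExcessLoss hbdd hU hε.measurable (hGF b) (hFL b)]

end Regret

section Parameters

lemma rpow_mul_rpow_le_sqrt_mul_sqrt {x y κ : ℝ} (hx : 0 < x) (hxy : x ≤ y) (hκ : 1 / 2 ≤ κ) :
    x ^ κ * y ^ (1 - κ) ≤ √x * √y := by
  have hy : 0 < y := hx.trans_le hxy
  have hx_split : x ^ κ = √x * x ^ (κ - 1 / 2) := by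
    rw [Real.sqrt_eq_rpow, ← Real.rpow_add hx, add_sub_cancel]
  have hy_split : √y = y ^ (κ - 1 / 2) * y ^ (1 - κ) := by
    rw [Real.sqrt_eq_rpow, ← Real.rpow_add hy]
    ring_nf
  rw [hx_split, hy_split, mul_assoc]
  gcongr

/- With `⌈T * δ / B⌉` rounds per batch there are about `B / δ` switches; if this is more than `T`,
then a single batch is the best choice. -/
lemma exists_batchLength {T : ℕ} {B δ : ℝ} (hB : 0 < B) (hBT : B ≤ T) (hδ : 0 < δ) :
    ∃ Δ : ℕ, 1 ≤ Δ ∧ Δ ≤ T ∧ ((T - 1) / Δ : ℕ) * δ ≤ B ∧ Δ * B ≤ (δ + 1) * T := by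
  have hT : (0 : ℝ) < T := hB.trans_le hBT
  have hT_one : 1 ≤ T := Nat.cast_pos.mp hT
  have h_ceil : (⌈T * δ / B⌉₊ : ℝ) * B ≤ (δ + 1) * T :=
    calc (⌈T * δ / B⌉₊ : ℝ) * B ≤ (T * δ / B + 1) * B := by
          gcongr
          exact (Nat.ceil_lt_add_one (by positivity)).le
      _ = T * δ + B := by field_simp
      _ ≤ (δ + 1) * T := by linarith
  rcases le_total T ⌈T * δ / B⌉₊ with h | h
  · refine ⟨T, hT_one, le_rfl, ?_, le_trans (by gcongr) h_ceil⟩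
    rw [Nat.div_eq_of_lt (Nat.sub_lt hT_one one_pos), Nat.cast_zero, zero_mul]
    exact hB.le
  · have h_pos : 0 < ⌈T * δ / B⌉₊ := Nat.ceil_pos.mpr (by positivity)
    refine ⟨⌈T * δ / B⌉₊, h_pos, h, ?_, h_ceil⟩
    have h_switches : (((T - 1) / ⌈T * δ / B⌉₊ : ℕ) : ℝ) ≤ T / (T * δ / B) :=
      calc (((T - 1) / ⌈T * δ / B⌉₊ : ℕ) : ℝ) ≤ (T - 1 : ℕ) / (⌈T * δ / B⌉₊ : ℝ) := Nat.cast_div_le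
        _ ≤ T / (T * δ / B) := by
          gcongr
          · exact Nat.sub_le T 1
          · exact Nat.le_ceil _
    calc (((T - 1) / ⌈T * δ / B⌉₊ : ℕ) : ℝ) * δ ≤ T / (T * δ / B) * δ := by gcongr
      _ = B := by field_simp

lemma exists_slope {K δ D B T κ : ℝ} (hK : 0 < K) (hδ : 0 < δ) (hD : 0 < D) (hB : 0 < B)
    (hBT : B ≤ T) (hκ : 1 / 2 ≤ κ) (hDB : D * B ≤ (δ + 1) * T) :
    ∃ η : ℝ, 0 < η ∧ D * (K * (2 * η) ^ 2) ≤ 1 / 8 ∧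
      δ / (4 * √(32 * K * (δ + 1))) * B ^ κ * T ^ (1 - κ) ≤ T * (η * δ / 4) := by
  have hT : 0 < T := hB.trans_le hBT
  refine ⟨(√(32 * K * D))⁻¹, by positivity, ?_, ?_⟩
  · rw [mul_pow, inv_pow, Real.sq_sqrt (by positivity)]
    apply le_of_eq
    field_simp
    norm_num
  have h_sqrt : √B * √(32 * K * D) ≤ √(32 * K * (δ + 1)) * √T := by
    rw [← Real.sqrt_mul hB.le, ← Real.sqrt_mul (by positivity)]
    apply Real.sqrt_le_sqrt
    linarith [mul_le_mul_of_nonneg_left hDB (by positivity : 0 ≤ 32 * K)]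
  calc δ / (4 * √(32 * K * (δ + 1))) * B ^ κ * T ^ (1 - κ)
      = δ / (4 * √(32 * K * (δ + 1))) * (B ^ κ * T ^ (1 - κ)) := mul_assoc _ _ _
    _ ≤ δ / (4 * √(32 * K * (δ + 1))) * (√B * √T) := by
        gcongr ?_ * ?_
        exact rpow_mul_rpow_le_sqrt_mul_sqrt hB hBT hκ
    _ = √B * √(32 * K * D) * (√T * δ / (4 * √(32 * K * (δ + 1)) * √(32 * K * D))) := by field_simp
    _ ≤ √(32 * K * (δ + 1)) * √T *
        (√T * δ / (4 * √(32 * K * (δ + 1)) * √(32 * K * D))) := by gcongr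
    _ = √T ^ 2 * ((√(32 * K * D))⁻¹ * δ / 4) := by field_simp
    _ = T * ((√(32 * K * D))⁻¹ * δ / 4) := by rw [Real.sq_sqrt hT.le]

end Parameters

theorem mainTheorem1_general {d : ℕ} (Ω : Set (EuclideanSpace ℝ (Fin d)))
    (hbdd : Bornology.IsBounded Ω) (hnt : Ω.Nontrivial) (K : ℝ) (hK : 0 < K) :
    ∃ C : ℝ, 0 < C ∧ ∀ (κ : ℝ), 1 / 2 ≤ κ → ∀ (T : ℕ) (B : ℝ), 0 < B → B ≤ T →
      ∃ V' : Set (Fin T → EuclideanSpace ℝ (Fin d) → ℝ),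
        V' ⊆ pathVariationClass Ω T B ∧
        (∃ (f g : EuclideanSpace ℝ (Fin d) → ℝ) (Δ : ℕ), 1 ≤ Δ ∧ Δ ≤ T ∧
          (∀ m : ℝ, 0 < m → ¬ StrongConvexOn Ω m f ∧ ¬ StrongConvexOn Ω m g) ∧
          V' = batchFamily T Δ f g) ∧
        ∀ (S : Type*) [MeasurableSpace S] (μ : Measure S) [IsProbabilityMeasure μ]
          (𝕌 : Type*) [MeasurableSpace 𝕌] (U : S → 𝕌)
          (ε : ℕ → S → EuclideanSpace ℝ (Fin d)) (lam : ℝ),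
          Measurable U → IsNoise μ ε lam K → IndepFun U (fun s t => ε t s) μ →
          ∀ (π : Policy Ω 𝕌)
            (G : ℕ → (EuclideanSpace ℝ (Fin d) → ℝ) → EuclideanSpace ℝ (Fin d) →
              EuclideanSpace ℝ (Fin d)),
            IsSubgradientOracle Ω G →
            ((C * B ^ κ * (T : ℝ) ^ (1 - κ) : ℝ) : EReal) ≤ worstRegret μ U ε π G V' := by
  obtain ⟨a, ha, b, hb, hab⟩ := hnt
  have hδ : 0 < dist a b := dist_pos.mpr hab
  refine ⟨dist a b / (4 * √(32 * K * (dist a b + 1))), by positivity, fun κ hκ T B hB hBT => ?_⟩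
  obtain ⟨Δ, hΔ, hΔT, h_switches, h_length⟩ := exists_batchLength hB hBT hδ
  obtain ⟨η, hη, h_info, h_rate⟩ := exists_slope hK hδ (Nat.cast_pos.mpr hΔ) hB hBT hκ h_length
  lift η to NNReal using hη.le
  rw [NNReal.coe_pos] at hη
  refine ⟨batchFamily T Δ (cone η a) (cone η b),
    batchFamily_subset_pathVariationClass (convexOn_cone η a) (convexOn_cone η b)
      (minimizers_cone hη ha) (minimizers_cone hη hb) h_switches,
    ⟨_, _, Δ, hΔ, hΔT, fun m hm => ⟨not_strongConvexOn_cone η ha hb hab hm,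
      not_strongConvexOn_cone η hb ha hab.symm hm⟩, rfl⟩, ?_⟩
  intro S _ μ _ 𝕌 _ U ε lam hU hε hUε π G hG
  have h_sep (x : EuclideanSpace ℝ (Fin d)) (_ : x ∈ Ω) :
      η * dist a b ≤ excessLoss Ω (cone η a) x + excessLoss Ω (cone η b) x := by
    simpa only [excessLoss_cone η ha, excessLoss_cone η hb] using mul_dist_le_cone_add_cone η a b x
  obtain ⟨F, hF, h_regret⟩ := exists_batchFamily_mul_le_dynamicRegret (T := T) (π := π) hbdd hK.le
    hU hε hUε hG (convexOn_cone η a) (convexOn_cone η b) (lipschitzWith_cone η a)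
    (lipschitzWith_cone η b) (by positivity) h_sep hΔ h_info
  exact (EReal.coe_le_coe_iff.mpr (h_rate.trans h_regret)).trans
    (le_iSup₂ (f := fun F _ => (dynamicRegret μ U ε π G F : EReal)) F hF)

theorem mainTheorem1 {d : ℕ} (Ω : Set (EuclideanSpace ℝ (Fin d)))
    (hΩ : Convex ℝ Ω) (hbdd : Bornology.IsBounded Ω) (hnt : Ω.Nontrivial)
    (K : ℝ) (hK : 0 < K) (κ : ℝ) (hκ : 1 / 2 < κ) (hκ' : κ < 1) :
    ∃ C : ℝ, 0 < C ∧ ∀ (T : ℕ) (B : ℝ), 1 ≤ B → B ≤ T →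
      ∃ V' : Set (Fin T → EuclideanSpace ℝ (Fin d) → ℝ),
        V' ⊆ pathVariationClass Ω T B ∧
        (∃ (f g : EuclideanSpace ℝ (Fin d) → ℝ) (Δ : ℕ), 1 ≤ Δ ∧ Δ ≤ T ∧
          (∀ m : ℝ, 0 < m → ¬ StrongConvexOn Ω m f ∧ ¬ StrongConvexOn Ω m g) ∧
          V' = batchFamily T Δ f g) ∧
        ∀ (S : Type*) [MeasurableSpace S] (μ : Measure S) [IsProbabilityMeasure μ]
          (𝕌 : Type*) [MeasurableSpace 𝕌] (U : S → 𝕌)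
          (ε : ℕ → S → EuclideanSpace ℝ (Fin d)) (lam : ℝ),
          Measurable U → IsNoise μ ε lam K → IndepFun U (fun s t => ε t s) μ →
          ∀ (π : Policy Ω 𝕌)
            (G : ℕ → (EuclideanSpace ℝ (Fin d) → ℝ) → EuclideanSpace ℝ (Fin d) →
              EuclideanSpace ℝ (Fin d)),
            IsSubgradientOracle Ω G →
            ((C * B ^ κ * (T : ℝ) ^ (1 - κ) : ℝ) : EReal) ≤ worstRegret μ U ε π G V' := by
  obtain ⟨C, hC, h⟩ := mainTheorem1_general Ω hbdd hnt K hK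
  exact ⟨C, hC, fun T B hB => h κ hκ.le T B (one_pos.trans_le hB)⟩
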